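/- Let $d_A,d_B$ be natural numbers. A unitary operator $W$ on $\mathbb{C}^{d_A}\otimes\mathbb{C}^{d_B}$ is called a controlled unitary (with respect to the bipartite cut $A$-$B$) if there are unitaries $P,R$ on $\mathbb{C}^{d_A}$ and $Q,S$ on $\mathbb{C}^{d_B}$ such that $W=(P\otimes Q)\,D\,(R\otimes S)$, where either $D=\sum_{j=1}^{d_A}|j\rangle\langle j|\otimes U_j$ with unitaries $U_j$ on $\mathbb{C}^{d_B}$, or $D=\sum_{j=1}^{d_B}V_j\otimes|j\rangle\langle j|$ with unitaries $V_j$ on $\mathbb{C}^{d_A}$. For a unitary $U$ on $\mathbb{C}^{d_A}\otimes\mathbb{C}^{d_B}$ let $$c(U)=\min\{k\ge 1 : U=U_1U_2\cdots U_k \text{ with each } U_i \text{ a controlled unitary on the same bipartite space}\}.$$ For every $d_A,d_B$ and every unitary $U$ on $\mathbb{C}^{d_A}\otimes\mathbb{C}^{d_B}$, decompositions as above exist for $U$ and for $U\otimes I_G$ (so that both minima are well defined), and $$c(U)\ \ge\ c(U\otimes I_G),$$ where $G=\mathbb{C}^2$ is a qubit added on the $A$ side, i.e. $U\otimes I_G$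 is regarded as a bipartite unitary on $(\mathbb{C}^{d_A}\otimes G)\otimes\mathbb{C}^{d_B}$. Moreover, there exist $d_A,d_B$ and a unitary $U$ on $\mathbb{C}^{d_A}\otimes\mathbb{C}^{d_B}$ for which $c(U)>c(U\otimes I_G)$. -/

import Mathlib

open scoped Kronecker

namespace BipartiteDepth

/-- `W` is controlled from the `A` side: it equals `∑ j, |j⟩⟨j| ⊗ U j`, with every `U j` unitary,
up to multiplication by local unitaries on both sides. -/
def IsControlledFromA {A B : Type*} [Fintype A] [DecidableEq A] [Fintype B] [DecidableEq B]
    (W : Matrix (A × B) (A × B) ℂ) : Prop :=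
  ∃ P ∈ Matrix.unitaryGroup A ℂ, ∃ Q ∈ Matrix.unitaryGroup B ℂ,
  ∃ R ∈ Matrix.unitaryGroup A ℂ, ∃ S ∈ Matrix.unitaryGroup B ℂ,
  ∃ U : A → Matrix B B ℂ, (∀ j, U j ∈ Matrix.unitaryGroup B ℂ) ∧
    W = (P ⊗ₖ Q) * (∑ j, Matrix.single j j (1 : ℂ) ⊗ₖ U j) * (R ⊗ₖ S)

/-- `W` is controlled from the `B` side: it equals `∑ j, V j ⊗ |j⟩⟨j|`, with every `V j` unitary,
up to multiplication by local unitaries on both sides. -/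
def IsControlledFromB {A B : Type*} [Fintype A] [DecidableEq A] [Fintype B] [DecidableEq B]
    (W : Matrix (A × B) (A × B) ℂ) : Prop :=
  ∃ P ∈ Matrix.unitaryGroup A ℂ, ∃ Q ∈ Matrix.unitaryGroup B ℂ,
  ∃ R ∈ Matrix.unitaryGroup A ℂ, ∃ S ∈ Matrix.unitaryGroup B ℂ,
  ∃ V : B → Matrix A A ℂ, (∀ j, V j ∈ Matrix.unitaryGroup A ℂ) ∧
    W = (P ⊗ₖ Q) * (∑ j, V j ⊗ₖ Matrix.single j j (1 : ℂ)) * (R ⊗ₖ S)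

/-- The bipartite controlled unitaries on the system `A`-`B`. -/
def IsControlledUnitary {A B : Type*} [Fintype A] [DecidableEq A] [Fintype B] [DecidableEq B]
    (W : Matrix (A × B) (A × B) ℂ) : Prop :=
  IsControlledFromA W ∨ IsControlledFromB W

/-- `U = U₁ U₂ ⋯ U_k` with `k ≥ 1` and all `U_i` controlled unitaries on the system `A`-`B`. -/
def IsProductOfControlled {A B : Type*} [Fintype A] [DecidableEq A] [Fintype B] [DecidableEq B]
    (U : Matrix (A × B) (A × B) ℂ) (k : ℕ) : Prop :=
  1 ≤ k ∧ ∃ L : List (Matrix (A × B) (A × B) ℂ),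
    L.length = k ∧ (∀ W ∈ L, IsControlledUnitary W) ∧ L.prod = U

/-- The bipartite depth `c(U)`: the least number of controlled unitaries in a decomposition. -/
noncomputable def depth {A B : Type*} [Fintype A] [DecidableEq A] [Fintype B] [DecidableEq B]
    (U : Matrix (A × B) (A × B) ℂ) : ℕ :=
  sInf {k : ℕ | IsProductOfControlled U k}

/-- `U ⊗ I_G` as an operator on the bipartite system with first party `A × G`, second party `B`,
where `G` is a qubit. -/
def tensorQubitA {A B : Type*} (U : Matrix (A × B) (A × B) ℂ) :
    Matrix ((A × Fin 2) × B) ((A × Fin 2) × B) ℂ :=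
  (U ⊗ₖ (1 : Matrix (Fin 2) (Fin 2) ℂ)).submatrix
    (fun x => ((x.1.1, x.2), x.1.2)) (fun x => ((x.1.1, x.2), x.1.2))

end BipartiteDepth

set_option linter.unusedSectionVars false

namespace BipartiteDepth

/-! ### Entries and adjoints of controlled gates. -/

section Basic

variable {A B : Type*} [Fintype A] [DecidableEq A] [Fintype B] [DecidableEq B]

/-! Adjoining the qubit is multiplicative and preserves controlled gates, so a decomposition of `U`
gives one of equal length for the extension. Decompositions exist because a unitary is a product of
phases on its eigenlines, and a product of two controlled gates carries a basis vector to any unit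
vector (`exists_mem_controlledMonoid_col`).

The two-qubit swap witnesses strictness. If it were W₁W₂, the partial transpose of W₁ would be a row
permutation of the realignment of W₂*. The former is again a controlled unitary, of rank 4; the
latter has rank at most 2 (`mul_ne_swapGate`). With the ancilla, two gates controlled in the Bell
basis suffice, by Pauli commutation and completeness (`sum_pauli`). -/

theorem sum_single_kronecker_apply (U : A → Matrix B B ℂ) (x y : A × B) :
    (∑ j, Matrix.single j j (1 : ℂ) ⊗ₖ U j) x y = if x.1 = y.1 then U x.1 x.2 y.2 else 0 := by
  rw [Matrix.sum_apply]
  by_cases h : x.1 = y.1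
  · rw [Finset.sum_eq_single x.1] <;> simp +contextual [h]
  · rw [if_neg h]
    refine Finset.sum_eq_zero fun j _ => ?_
    simp only [Matrix.kroneckerMap_apply, Matrix.single_apply]
    rw [if_neg (by rintro ⟨rfl, h'⟩; exact h h'), zero_mul]

theorem sum_kronecker_single_apply (V : B → Matrix A A ℂ) (x y : A × B) :
    (∑ j, V j ⊗ₖ Matrix.single j j (1 : ℂ)) x y = if x.2 = y.2 then V x.2 x.1 y.1 else 0 := by
  rw [Matrix.sum_apply]
  by_cases h : x.2 = y.2
  · rw [Finset.sum_eq_single x.2] <;> simp +contextual [h]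
  · rw [if_neg h]
    refine Finset.sum_eq_zero fun j _ => ?_
    simp only [Matrix.kroneckerMap_apply, Matrix.single_apply]
    rw [if_neg (by rintro ⟨rfl, h'⟩; exact h h'), mul_zero]

theorem isControlledFromA_sum {U : A → Matrix B B ℂ}
    (hU : ∀ j, U j ∈ Matrix.unitaryGroup B ℂ) :
    IsControlledFromA (∑ j, Matrix.single j j (1 : ℂ) ⊗ₖ U j) :=
  ⟨1, one_mem _, 1, one_mem _, 1, one_mem _, 1, one_mem _, U, hU, by simp⟩

theorem isControlledFromB_sum {V : B → Matrix A A ℂ}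
    (hV : ∀ j, V j ∈ Matrix.unitaryGroup A ℂ) :
    IsControlledFromB (∑ j, V j ⊗ₖ Matrix.single j j (1 : ℂ)) :=
  ⟨1, one_mem _, 1, one_mem _, 1, one_mem _, 1, one_mem _, V, hV, by simp⟩

theorem isControlledFromA_one : IsControlledFromA (1 : Matrix (A × B) (A × B) ℂ) := by
  convert isControlledFromA_sum (A := A) (U := fun _ => (1 : Matrix B B ℂ)) fun _ => one_mem _
  ext ⟨a, b⟩ ⟨a', b'⟩
  rw [sum_single_kronecker_apply]
  simp only [Matrix.one_apply, Prod.mk.injEq]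
  split_ifs <;> simp_all

theorem IsControlledUnitary.star {W : Matrix (A × B) (A × B) ℂ} (h : IsControlledUnitary W) :
    IsControlledUnitary (star W) := by
  rcases h with ⟨P, hP, Q, hQ, R, hR, S, hS, U, hU, rfl⟩ | ⟨P, hP, Q, hQ, R, hR, S, hS, U, hU, rfl⟩
  · refine Or.inl ⟨_, Unitary.star_mem hR, _, Unitary.star_mem hS, _, Unitary.star_mem hP, _,
      Unitary.star_mem hQ, _, fun j => Unitary.star_mem (hU j), ?_⟩
    simp [Matrix.star_eq_conjTranspose, Matrix.conjTranspose_kronecker, Matrix.conjTranspose_sum,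
      mul_assoc]
  · refine Or.inr ⟨_, Unitary.star_mem hR, _, Unitary.star_mem hS, _, Unitary.star_mem hP, _,
      Unitary.star_mem hQ, _, fun j => Unitary.star_mem (hU j), ?_⟩
    simp [Matrix.star_eq_conjTranspose, Matrix.conjTranspose_kronecker, Matrix.conjTranspose_sum,
      mul_assoc]

end Basic

/-! ### Adjoining a qubit does not increase depth. -/

section Ancilla

variable {A B : Type*}

theorem tensorQubitA_apply (M : Matrix (A × B) (A × B) ℂ) (x y : (A × Fin 2) × B) :
    tensorQubitA M x y = if x.1.2 = y.1.2 then M (x.1.1, x.2) (y.1.1, y.2) else 0 := by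
  simp [tensorQubitA, Matrix.one_apply]

theorem tensorQubitA_kronecker (M : Matrix A A ℂ) (N : Matrix B B ℂ) :
    tensorQubitA (M ⊗ₖ N) = (M ⊗ₖ (1 : Matrix (Fin 2) (Fin 2) ℂ)) ⊗ₖ N := by
  ext x y
  simp [tensorQubitA, mul_right_comm]

variable [Fintype A] [DecidableEq A] [Fintype B] [DecidableEq B]

theorem tensorQubitA_mul (M N : Matrix (A × B) (A × B) ℂ) :
    tensorQubitA (M * N) = tensorQubitA M * tensorQubitA N := by
  let e : (A × Fin 2) × B ≃ (A × B) × Fin 2 :=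
    ⟨fun x => ((x.1.1, x.2), x.1.2), fun x => ((x.1.1, x.2), x.1.2), fun _ => rfl, fun _ => rfl⟩
  change ((M * N) ⊗ₖ (1 : Matrix (Fin 2) (Fin 2) ℂ)).submatrix e e =
    (M ⊗ₖ (1 : Matrix (Fin 2) (Fin 2) ℂ)).submatrix e e *
      (N ⊗ₖ (1 : Matrix (Fin 2) (Fin 2) ℂ)).submatrix e e
  rw [Matrix.submatrix_mul_equiv, ← Matrix.mul_kronecker_mul, one_mul]

theorem tensorQubitA_one : tensorQubitA (1 : Matrix (A × B) (A × B) ℂ) = 1 := by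
  rw [← Matrix.one_kronecker_one, tensorQubitA_kronecker, Matrix.one_kronecker_one,
    Matrix.one_kronecker_one]

theorem tensorQubitA_list_prod (L : List (Matrix (A × B) (A × B) ℂ)) :
    tensorQubitA L.prod = (L.map tensorQubitA).prod := by
  induction L with
  | nil => simp [tensorQubitA_one]
  | cons W L ih => simp [tensorQubitA_mul, ih]

theorem IsControlledUnitary.tensorQubitA {W : Matrix (A × B) (A × B) ℂ}
    (h : IsControlledUnitary W) : IsControlledUnitary (tensorQubitA W) := by
  rcases h with ⟨P, hP, Q, hQ, R, hR, S, hS, U, hU, rfl⟩ | ⟨P, hP, Q, hQ, R, hR, S, hS, U, hU, rfl⟩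
  · refine Or.inl ⟨_, Matrix.kronecker_mem_unitary hP (one_mem _), Q, hQ, _,
      Matrix.kronecker_mem_unitary hR (one_mem _), S, hS, fun j => U j.1, fun j => hU _, ?_⟩
    rw [tensorQubitA_mul, tensorQubitA_mul, tensorQubitA_kronecker, tensorQubitA_kronecker]
    congr 2
    ext x y
    rw [tensorQubitA_apply, sum_single_kronecker_apply, sum_single_kronecker_apply]
    simp only [Prod.ext_iff]
    split_ifs <;> simp_all
  · refine Or.inr ⟨_, Matrix.kronecker_mem_unitary hP (one_mem _), Q, hQ, _,
      Matrix.kronecker_mem_unitary hR (one_mem _), S, hS, fun j => U j ⊗ₖ 1,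
      fun j => Matrix.kronecker_mem_unitary (hU j) (one_mem _), ?_⟩
    rw [tensorQubitA_mul, tensorQubitA_mul, tensorQubitA_kronecker, tensorQubitA_kronecker]
    congr 2
    ext x y
    rw [tensorQubitA_apply, sum_kronecker_single_apply, sum_kronecker_single_apply]
    simp only [Matrix.kroneckerMap_apply, Matrix.one_apply]
    split_ifs <;> simp_all

theorem IsProductOfControlled.tensorQubitA {U : Matrix (A × B) (A × B) ℂ} {k : ℕ}
    (h : IsProductOfControlled U k) : IsProductOfControlled (tensorQubitA U) k := by
  obtain ⟨hk, L, hL, hW, rfl⟩ := h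
  refine ⟨hk, L.map BipartiteDepth.tensorQubitA, by simpa using hL, ?_,
    (tensorQubitA_list_prod L).symm⟩
  intro W hWL
  obtain ⟨W', hW', rfl⟩ := List.mem_map.1 hWL
  exact (hW W' hW').tensorQubitA

theorem depth_tensorQubitA_le {U : Matrix (A × B) (A × B) ℂ}
    (h : ∃ k, IsProductOfControlled U k) : depth (tensorQubitA U) ≤ depth U :=
  Nat.sInf_le (IsProductOfControlled.tensorQubitA (Nat.sInf_mem h))

end Ancilla

/-! ### Controlled gates generate the unitary group. -/

section Universality

theorem exists_unitary_col_eq {n : Type*} [Fintype n] [DecidableEq n] (i : n)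
    {v : n → ℂ} (hv : ∑ j, ‖v j‖ ^ 2 = 1) :
    ∃ V ∈ Matrix.unitaryGroup n ℂ, ∀ j, V j i = v j := by
  have hnorm : ‖WithLp.toLp 2 v‖ = 1 := by
    rw [EuclideanSpace.norm_eq]; simp [hv]
  obtain ⟨b, hb⟩ := Orthonormal.exists_orthonormalBasis_extension_of_card_eq (𝕜 := ℂ)
    (E := EuclideanSpace ℂ n) (ι := n) (by simp) (v := fun _ => WithLp.toLp 2 v) (s := {i}) (by
      rw [orthonormal_iff_ite]
      rintro ⟨j, rfl⟩ ⟨k, rfl⟩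
      simp [inner_self_eq_norm_sq_to_K, hnorm])
  refine ⟨_, (EuclideanSpace.basisFun n ℂ).toMatrix_orthonormalBasis_mem_unitary b, fun j => ?_⟩
  simp [Module.Basis.toMatrix_apply, hb i rfl]

theorem exists_unitary_col_mul_norm_eq {n : Type*} [Fintype n] [DecidableEq n] (i : n) (v : n → ℂ) :
    ∃ V ∈ Matrix.unitaryGroup n ℂ, ∀ j, V j i * (√(∑ k, ‖v k‖ ^ 2) : ℝ) = v j := by
  have h0 : 0 ≤ ∑ k, ‖v k‖ ^ 2 := by positivity
  by_cases h : ∑ k, ‖v k‖ ^ 2 = 0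
  · refine ⟨1, one_mem _, fun j => ?_⟩
    rw [Finset.sum_eq_zero_iff_of_nonneg (fun _ _ => by positivity)] at h
    have hj := h j (Finset.mem_univ _)
    rw [(Finset.sum_eq_zero_iff_of_nonneg (fun _ _ => by positivity)).2 h]
    simp_all
  · have hs : √(∑ k, ‖v k‖ ^ 2) ≠ 0 := by rwa [Ne, Real.sqrt_eq_zero h0]
    obtain ⟨V, hV, hVi⟩ := exists_unitary_col_eq i
      (v := fun j => v j / (√(∑ k, ‖v k‖ ^ 2) : ℝ)) (by
        simp only [norm_div, Complex.norm_real, Real.norm_eq_abs, abs_of_nonneg (Real.sqrt_nonneg _),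
          div_pow, Real.sq_sqrt h0]
        rw [← Finset.sum_div, div_self h])
    refine ⟨V, hV, fun j => ?_⟩
    rw [hVi, div_mul_cancel₀]
    exact_mod_cast hs

-- Write U = exp(iH) with H = arg(U) and diagonalize the Hermitian H. The jump of arg is harmless
-- because the spectrum is finite.
open scoped Matrix.Norms.L2Operator in
theorem exists_eq_conj_diagonal {n : Type*} [Fintype n] [DecidableEq n] {U : Matrix n n ℂ}
    (hU : U ∈ Matrix.unitaryGroup n ℂ) :
    ∃ V ∈ Matrix.unitaryGroup n ℂ, ∃ z : n → ℂ, (∀ i, ‖z i‖ = 1) ∧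
      U = V * Matrix.diagonal z * star V := by
  have hn : IsStarNormal U := ⟨by rw [commute_iff_eq, hU.1, hU.2]⟩
  have hfin : (spectrum ℂ U).Finite := Matrix.finite_spectrum U
  have hc (f : ℂ → ℂ) : ContinuousOn f (spectrum ℂ U) := hfin.continuousOn f
  have hH : IsSelfAdjoint (cfc (Complex.ofReal ∘ Complex.arg : ℂ → ℂ) U) := .cfc_arg U
  have hE : NormedSpace.exp (Complex.I • cfc (Complex.ofReal ∘ Complex.arg : ℂ → ℂ) U) = U := by
    rw [← CFC.exp_eq_normedSpace_exp (𝕜 := ℂ), ← cfc_comp_smul ..,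
      ← cfc_comp' (hg := by fun_prop) (hf := hc _)]
    conv_rhs => rw [← cfc_id' ℂ U]
    refine cfc_congr fun y hy ↦ ?_
    have hy₁ : ‖y‖ = 1 := spectrum.norm_eq_one_of_unitary hU hy
    have : Complex.I * y.arg = Complex.log y :=
      Complex.ext (by simp [Complex.log_re, hy₁]) (by simp [Complex.log_im])
    simpa [← Complex.exp_eq_exp_ℂ, this] using Complex.exp_log (by aesop)
  generalize cfc (Complex.ofReal ∘ Complex.arg : ℂ → ℂ) U = H at hH hE
  have hH' : H.IsHermitian := hH
  have hV : hH'.eigenvectorUnitary * star (hH'.eigenvectorUnitary : Matrix n n ℂ) = 1 :=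
    hH'.eigenvectorUnitary.2.2
  refine ⟨hH'.eigenvectorUnitary, hH'.eigenvectorUnitary.2,
    fun i => Complex.exp (Complex.I * hH'.eigenvalues i), fun i => ?_, ?_⟩
  · simpa only [mul_comm] using Complex.norm_exp_ofReal_mul_I (hH'.eigenvalues i)
  · have hs := hH'.spectral_theorem
    rw [Unitary.conjStarAlgAut_apply, ← Matrix.inv_eq_right_inv hV] at hs
    have hI := congr_arg (fun M => NormedSpace.exp (Complex.I • M)) hs
    simp only [hE] at hI
    rw [← Matrix.smul_mul, ← Matrix.mul_smul, Matrix.exp_conj _ _ (IsUnit.of_mul_eq_one _ hV),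
      ← Matrix.diagonal_smul, Matrix.exp_diagonal, Matrix.inv_eq_right_inv hV] at hI
    rw [hI]
    congr 3
    ext i
    simp [Pi.coe_exp, Complex.exp_eq_exp_ℂ]

variable {A B : Type*} [Fintype A] [DecidableEq A] [Fintype B] [DecidableEq B]

/-- The operators that are products of controlled unitaries. -/
def controlledMonoid (A B : Type*) [Fintype A] [DecidableEq A] [Fintype B] [DecidableEq B] :
    Submonoid (Matrix (A × B) (A × B) ℂ) :=
  Submonoid.closure {W | IsControlledUnitary W}

theorem star_mem_controlledMonoid {g : Matrix (A × B) (A × B) ℂ}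
    (hg : g ∈ controlledMonoid A B) : star g ∈ controlledMonoid A B := by
  induction hg using Submonoid.closure_induction with
  | mem W hW => exact Submonoid.subset_closure (IsControlledUnitary.star hW)
  | one => simp
  | mul x y _ _ hx hy => rw [star_mul]; exact mul_mem hy hx

theorem sum_single_kronecker_mem_unitary {U : A → Matrix B B ℂ}
    (hU : ∀ j, U j ∈ Matrix.unitaryGroup B ℂ) :
    (∑ j, Matrix.single j j (1 : ℂ) ⊗ₖ U j) ∈ Matrix.unitaryGroup (A × B) ℂ := by
  rw [Matrix.mem_unitaryGroup_iff]
  ext x y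
  have h := congr_fun₂ (Matrix.mem_unitaryGroup_iff.1 (hU x.1)) x.2 y.2
  rw [Matrix.mul_apply, Fintype.sum_prod_type, Finset.sum_eq_single x.1 _ (by simp)]
  · simp only [Matrix.star_apply, sum_single_kronecker_apply]
    by_cases hxy : x.1 = y.1
    · simp only [Matrix.mul_apply, Matrix.star_apply, Matrix.one_apply] at h
      simp [hxy, Matrix.one_apply, Prod.ext_iff] at h ⊢
      exact h
    · simp [Ne.symm hxy, Prod.ext_iff, hxy]
  · intro a _ ha
    simp [sum_single_kronecker_apply, ha.symm]

theorem sum_kronecker_single_mem_unitary {V : B → Matrix A A ℂ}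
    (hV : ∀ j, V j ∈ Matrix.unitaryGroup A ℂ) :
    (∑ j, V j ⊗ₖ Matrix.single j j (1 : ℂ)) ∈ Matrix.unitaryGroup (A × B) ℂ := by
  rw [Matrix.mem_unitaryGroup_iff]
  ext x y
  have h := congr_fun₂ (Matrix.mem_unitaryGroup_iff.1 (hV x.2)) x.1 y.1
  rw [Matrix.mul_apply, Fintype.sum_prod_type_right, Finset.sum_eq_single x.2 _ (by simp)]
  · simp only [Matrix.star_apply, sum_kronecker_single_apply]
    by_cases hxy : x.2 = y.2
    · simp only [Matrix.mul_apply, Matrix.star_apply, Matrix.one_apply] at h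
      simp [hxy, Matrix.one_apply, Prod.ext_iff] at h ⊢
      exact h
    · simp [Ne.symm hxy, Prod.ext_iff, hxy]
  · intro a _ ha
    simp [sum_kronecker_single_apply, ha.symm]

theorem IsControlledUnitary.mem_unitaryGroup {W : Matrix (A × B) (A × B) ℂ}
    (h : IsControlledUnitary W) : W ∈ Matrix.unitaryGroup (A × B) ℂ := by
  rcases h with ⟨P, hP, Q, hQ, R, hR, S, hS, U, hU, rfl⟩ | ⟨P, hP, Q, hQ, R, hR, S, hS, U, hU, rfl⟩
  · exact mul_mem (mul_mem (Matrix.kronecker_mem_unitary hP hQ)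
      (sum_single_kronecker_mem_unitary hU)) (Matrix.kronecker_mem_unitary hR hS)
  · exact mul_mem (mul_mem (Matrix.kronecker_mem_unitary hP hQ)
      (sum_kronecker_single_mem_unitary hU)) (Matrix.kronecker_mem_unitary hR hS)

theorem controlledMonoid_le_unitaryGroup :
    controlledMonoid A B ≤ Matrix.unitaryGroup (A × B) ℂ :=
  Submonoid.closure_le.2 fun _ h => IsControlledUnitary.mem_unitaryGroup h

/-- Rotate A so that |a⟩ has amplitude the norm of the block v(a, ·), then, controlled on a, rotate
B to that block's direction. -/
theorem exists_mem_controlledMonoid_col (p : A × B) {v : A × B → ℂ}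
    (hv : ∑ j, ‖v j‖ ^ 2 = 1) : ∃ g ∈ controlledMonoid A B, ∀ x, g x p = v x := by
  choose U hU hUv using fun a => exists_unitary_col_mul_norm_eq p.2 fun b => v (a, b)
  obtain ⟨V, hV, hVv⟩ := exists_unitary_col_eq p.1
    (v := fun a => ((√(∑ b, ‖v (a, b)‖ ^ 2) : ℝ) : ℂ)) (by
      simp only [Complex.norm_real, Real.norm_eq_abs, sq_abs]
      rw [← hv, Fintype.sum_prod_type]
      exact Finset.sum_congr rfl fun a _ => Real.sq_sqrt (by positivity))
  refine ⟨_, mul_mem (Submonoid.subset_closure (Or.inl (isControlledFromA_sum hU)))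
    (Submonoid.subset_closure (Or.inr (isControlledFromB_sum fun _ : B => hV))), fun x => ?_⟩
  rw [Matrix.mul_apply, Finset.sum_eq_single (x.1, p.2) _ (by simp)]
  · rw [sum_single_kronecker_apply, sum_kronecker_single_apply, if_pos rfl, if_pos rfl]
    simp only [hVv, hUv]
  · intro y _ hy
    rw [sum_single_kronecker_apply, sum_kronecker_single_apply]
    split_ifs with h1 h2
    · exact absurd (Prod.ext h1.symm h2 : y = (x.1, p.2)) hy
    all_goals simp

/-- The conjugate of `1 + z |i⟩⟨i|` by a unitary `V` depends only on the `i`-th column of `V`. -/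
theorem conj_one_add_single_apply {n : Type*} [Fintype n] [DecidableEq n] {V : Matrix n n ℂ}
    (hV : V ∈ Matrix.unitaryGroup n ℂ) (i : n) (z : ℂ) (x y : n) :
    (V * (1 + Matrix.single i i z) * star V) x y =
      (1 : Matrix n n ℂ) x y + z * V x i * star (V y i) := by
  rw [mul_add, add_mul, mul_one, Matrix.mem_unitaryGroup_iff.1 hV, Matrix.add_apply]
  congr 1
  rw [Matrix.mul_apply, Finset.sum_eq_single i _ (by simp)]
  · simp [mul_comm]
  · intro j _ hj
    simp [hj]

theorem one_add_single_eq_diagonal_update {n : Type*} [DecidableEq n] (i : n) (z : ℂ) :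
    (1 + Matrix.single i i (z - 1) : Matrix n n ℂ) =
      Matrix.diagonal (Function.update 1 i z) := by
  ext x y
  by_cases hxy : x = y
  · subst hxy
    by_cases hx : x = i
    · subst hx; simp
    · simp [hx, Ne.symm hx]
  · have : ¬ (i = x ∧ i = y) := fun h => hxy (h.1.symm.trans h.2)
    simp [hxy, this]

theorem diagonal_mem_unitaryGroup {n : Type*} [Fintype n] [DecidableEq n] {z : n → ℂ}
    (hz : ∀ i, ‖z i‖ = 1) : Matrix.diagonal z ∈ Matrix.unitaryGroup n ℂ := by
  rw [Matrix.mem_unitaryGroup_iff, Matrix.star_eq_conjTranspose, Matrix.diagonal_conjTranspose,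
    Matrix.diagonal_mul_diagonal, ← Matrix.diagonal_one]
  congr 1
  ext i
  simp [Complex.mul_conj, Complex.normSq_eq_norm_sq, hz]

theorem diagonal_mem_controlledMonoid {z : A × B → ℂ} (hz : ∀ i, ‖z i‖ = 1) :
    Matrix.diagonal z ∈ controlledMonoid A B := by
  have h := isControlledFromA_sum fun a : A => diagonal_mem_unitaryGroup fun b : B => hz (a, b)
  refine Submonoid.subset_closure (Or.inl ?_)
  convert h
  ext ⟨a, b⟩ ⟨a', b'⟩
  rw [sum_single_kronecker_apply]
  simp only [Matrix.diagonal_apply, Prod.mk.injEq]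
  split_ifs <;> simp_all

/-- Only column i of V matters, so V may be replaced by a product of controlled gates with the same
column. -/
theorem conj_diagonal_update_mem {V : Matrix (A × B) (A × B) ℂ}
    (hV : V ∈ Matrix.unitaryGroup (A × B) ℂ) (i : A × B) {z : ℂ} (hz : ‖z‖ = 1) :
    V * Matrix.diagonal (Function.update 1 i z) * star V ∈ controlledMonoid A B := by
  have hcol : ∑ j, ‖V j i‖ ^ 2 = 1 := by
    have h := congr_fun₂ (Matrix.mem_unitaryGroup_iff'.1 hV) i i
    simp only [Matrix.mul_apply, Matrix.star_apply, RCLike.star_def, Complex.conj_mul',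
      Matrix.one_apply_eq] at h
    exact_mod_cast h
  obtain ⟨g, hg, hgV⟩ := exists_mem_controlledMonoid_col i hcol
  have : V * Matrix.diagonal (Function.update 1 i z) * star V =
      g * Matrix.diagonal (Function.update 1 i z) * star g := by
    ext x y
    rw [← one_add_single_eq_diagonal_update, conj_one_add_single_apply hV,
      conj_one_add_single_apply (controlledMonoid_le_unitaryGroup hg), hgV, hgV]
  rw [this]
  refine mul_mem (mul_mem hg (diagonal_mem_controlledMonoid fun j => ?_))
    (star_mem_controlledMonoid hg)
  by_cases hj : j = i
  · subst hj; simpa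
  · simp [hj]

theorem mem_controlledMonoid {U : Matrix (A × B) (A × B) ℂ}
    (hU : U ∈ Matrix.unitaryGroup (A × B) ℂ) : U ∈ controlledMonoid A B := by
  obtain ⟨V, hV, z, hz, rfl⟩ := exists_eq_conj_diagonal hU
  -- The eigenvalues are switched on one at a time.
  suffices ∀ s : Finset (A × B),
      V * Matrix.diagonal (fun i => if i ∈ s then z i else 1) * star V ∈ controlledMonoid A B by
    simpa using this Finset.univ
  intro s
  induction s using Finset.induction_on with
  | empty =>
    simp only [Finset.notMem_empty, if_false, Matrix.diagonal_one, mul_one,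
      Matrix.mem_unitaryGroup_iff.1 hV, one_mem]
  | insert i s hi ih =>
    convert mul_mem (conj_diagonal_update_mem hV i (hz i)) ih using 1
    rw [show ∀ X Y : Matrix (A × B) (A × B) ℂ, V * X * star V * (V * Y * star V) =
      V * (X * (star V * V) * Y) * star V from fun X Y => by simp only [mul_assoc],
      Matrix.mem_unitaryGroup_iff'.1 hV, mul_one, Matrix.diagonal_mul_diagonal]
    congr 3
    ext j
    by_cases hj : j = i
    · subst hj; simp [hi]
    · simp [hj]

theorem exists_isProductOfControlled {U : Matrix (A × B) (A × B) ℂ}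
    (hU : U ∈ Matrix.unitaryGroup (A × B) ℂ) : ∃ k, IsProductOfControlled U k := by
  obtain ⟨L, hL, rfl⟩ := Submonoid.exists_list_of_mem_closure (mem_controlledMonoid hU)
  -- The extra identity ensures k ≥ 1 even when `L` is empty.
  refine ⟨(1 :: L).length, by simp, 1 :: L, rfl, ?_, by simp⟩
  simp only [List.mem_cons, forall_eq_or_imp]
  exact ⟨Or.inl isControlledFromA_one, hL⟩

end Universality

/-! ### Partial transpose and operator Schmidt rank. -/

section PartialTranspose

variable {A B : Type*}

/-- The transpose of `M` in the `A` factor. -/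
def partialTranspose (M : Matrix (A × B) (A × B) ℂ) : Matrix (A × B) (A × B) ℂ :=
  Matrix.of fun x y => M (y.1, x.2) (x.1, y.2)

/-- The realignment of `M`, whose rank is the operator Schmidt rank of `M`. -/
def realign (M : Matrix (A × B) (A × B) ℂ) : Matrix (A × A) (B × B) ℂ :=
  Matrix.of fun p q => M (p.1, q.1) (p.2, q.2)

theorem partialTranspose_sum_kronecker {J : Type*} [Fintype J] (X : J → Matrix A A ℂ)
    (Y : J → Matrix B B ℂ) :
    partialTranspose (∑ j, X j ⊗ₖ Y j) = ∑ j, (X j).transpose ⊗ₖ Y j := by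
  ext x y
  simp [partialTranspose, Matrix.sum_apply]

variable [Fintype A] [DecidableEq A] [Fintype B] [DecidableEq B]

theorem kronecker_mul_sum_mul_kronecker {J : Type*} [Fintype J] (P R : Matrix A A ℂ)
    (Q S : Matrix B B ℂ) (X : J → Matrix A A ℂ) (Y : J → Matrix B B ℂ) :
    (P ⊗ₖ Q) * (∑ j, X j ⊗ₖ Y j) * (R ⊗ₖ S) = ∑ j, (P * X j * R) ⊗ₖ (Q * Y j * S) := by
  simp only [Finset.mul_sum, Finset.sum_mul, Matrix.mul_kronecker_mul]

theorem transpose_mem_unitaryGroup {n : Type*} [Fintype n] [DecidableEq n] {V : Matrix n n ℂ}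
    (hV : V ∈ Matrix.unitaryGroup n ℂ) : V.transpose ∈ Matrix.unitaryGroup n ℂ := by
  have h := congr_arg Matrix.transpose (Matrix.mem_unitaryGroup_iff'.1 hV)
  rw [Matrix.transpose_mul, Matrix.transpose_one] at h
  rw [Matrix.mem_unitaryGroup_iff]
  exact h

/-- Transposition acts termwise on the A factors, which stay unitary or diagonal units. General
unitaries lack this property: the partial transpose of the swap has rank one. -/
theorem IsControlledUnitary.partialTranspose {W : Matrix (A × B) (A × B) ℂ}
    (h : IsControlledUnitary W) : IsControlledUnitary (partialTranspose W) := by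
  rcases h with ⟨P, hP, Q, hQ, R, hR, S, hS, U, hU, rfl⟩ | ⟨P, hP, Q, hQ, R, hR, S, hS, V, hV, rfl⟩
  · refine Or.inl ⟨_, transpose_mem_unitaryGroup hR, Q, hQ, _, transpose_mem_unitaryGroup hP, S, hS,
      U, hU, ?_⟩
    simp only [kronecker_mul_sum_mul_kronecker, partialTranspose_sum_kronecker,
      Matrix.transpose_mul, Matrix.transpose_single]
    simp only [mul_assoc]
  · refine Or.inr ⟨_, transpose_mem_unitaryGroup hR, Q, hQ, _, transpose_mem_unitaryGroup hP, S, hS,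
      _, fun j => transpose_mem_unitaryGroup (hV j), ?_⟩
    simp only [kronecker_mul_sum_mul_kronecker, partialTranspose_sum_kronecker,
      Matrix.transpose_mul]
    simp only [mul_assoc]

/-- Realignment turns each product term into an outer product of vectorized factors. -/
theorem rank_realign_sum_kronecker_le {J : Type*} [Fintype J] (X : J → Matrix A A ℂ)
    (Y : J → Matrix B B ℂ) : (realign (∑ j, X j ⊗ₖ Y j)).rank ≤ Fintype.card J := by
  have : realign (∑ j, X j ⊗ₖ Y j) =
      (Matrix.of fun (p : A × A) j => X j p.1 p.2) *
        (Matrix.of fun j (q : B × B) => Y j q.1 q.2) := by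
    ext p q
    simp [realign, Matrix.sum_apply, Matrix.mul_apply]
  rw [this]
  exact (Matrix.rank_mul_le_left _ _).trans (Matrix.rank_le_card_width _)

theorem IsControlledUnitary.rank_realign_le {W : Matrix (A × B) (A × B) ℂ}
    (h : IsControlledUnitary W) :
    (realign W).rank ≤ max (Fintype.card A) (Fintype.card B) := by
  rcases h with ⟨P, hP, Q, hQ, R, hR, S, hS, U, hU, rfl⟩ | ⟨P, hP, Q, hQ, R, hR, S, hS, V, hV, rfl⟩
  · rw [kronecker_mul_sum_mul_kronecker]
    exact (rank_realign_sum_kronecker_le _ _).trans (le_max_left _ _)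
  · rw [kronecker_mul_sum_mul_kronecker]
    exact (rank_realign_sum_kronecker_le _ _).trans (le_max_right _ _)

end PartialTranspose

/-! ### The swap gate, without and with an ancilla. -/

section Swap

/-- The swap of two qubits. -/
def swapGate : Matrix (Fin 2 × Fin 2) (Fin 2 × Fin 2) ℂ :=
  Matrix.of fun x y => if x = y.swap then 1 else 0

theorem swapGate_mul_apply (N : Matrix (Fin 2 × Fin 2) (Fin 2 × Fin 2) ℂ) (x y : Fin 2 × Fin 2) :
    (swapGate * N) x y = N x.swap y := by
  rw [Matrix.mul_apply, Finset.sum_eq_single x.swap _ (by simp)]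
  · simp [swapGate]
  · intro z _ hz
    have : x ≠ z.swap := fun h => hz (by simp [h])
    simp [swapGate, this]

theorem swapGate_mem_unitaryGroup : swapGate ∈ Matrix.unitaryGroup (Fin 2 × Fin 2) ℂ := by
  rw [Matrix.mem_unitaryGroup_iff]
  ext x y
  rw [swapGate_mul_apply, Matrix.star_apply]
  simp [swapGate, Matrix.one_apply, eq_comm, apply_ite]

theorem mul_ne_swapGate {W₁ W₂ : Matrix (Fin 2 × Fin 2) (Fin 2 × Fin 2) ℂ}
    (h₁ : IsControlledUnitary W₁) (h₂ : IsControlledUnitary W₂) : W₁ * W₂ ≠ swapGate := by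
  intro h
  have hW : W₁ = swapGate * star W₂ := by
    rw [← h, mul_assoc, Matrix.mem_unitaryGroup_iff.1 h₂.mem_unitaryGroup, mul_one]
  have hpt : partialTranspose W₁ =
      (realign (star W₂)).submatrix (Equiv.prodComm _ _) (Equiv.refl _) := by
    ext x y
    rw [hW]
    simp only [partialTranspose, realign, Matrix.of_apply, Matrix.submatrix_apply,
      swapGate_mul_apply]
    rfl
  have hfull : (partialTranspose W₁).rank = 4 := by
    rw [Matrix.rank_of_isUnit _
      (IsUnit.of_mul_eq_one _ h₁.partialTranspose.mem_unitaryGroup.2)]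
    simp
  have hle := h₂.star.rank_realign_le
  rw [hpt, Matrix.rank_submatrix] at hfull
  simp [hfull] at hle

theorem two_lt_depth_swapGate : 2 < depth swapGate := by
  -- Existence matters here: `sInf` of the empty set would be 0.
  have hmem := Nat.sInf_mem (exists_isProductOfControlled swapGate_mem_unitaryGroup)
  obtain ⟨h1, L, hL, hW, hprod⟩ := hmem
  by_contra! hle
  change L.length = depth swapGate at hL
  match L, hL, hW, hprod with
  | [], hL, _, _ =>
    change 1 ≤ depth swapGate at h1
    simp only [List.length_nil] at hL
    omega
  | [W], _, hW, hprod =>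
    exact mul_ne_swapGate (hW W (by simp)) (Or.inl isControlledFromA_one) (by simpa using hprod)
  | [W₁, W₂], _, hW, hprod =>
    exact mul_ne_swapGate (hW W₁ (by simp)) (hW W₂ (by simp)) (by simpa using hprod)
  | _ :: _ :: _ :: _, hL, _, _ => simp at hL; omega

/-- The Pauli matrix `X ^ j.1 * Z ^ j.2`. -/
def pauli (j : Fin 2 × Fin 2) : Matrix (Fin 2) (Fin 2) ℤ :=
  Matrix.of fun b b' => if b = b' + j.1 then (-1) ^ (j.2 * b').val else 0

/-- The commutation signs of the Pauli matrices. -/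
def pauliSign : Matrix (Fin 2 × Fin 2) (Fin 2 × Fin 2) ℤ :=
  Matrix.of fun j k => (-1) ^ (j.1 * k.2 + j.2 * k.1).val

/-- The matrix whose columns are the vectorized Pauli matrices. -/
def pauliBasis : Matrix (Fin 2 × Fin 2) (Fin 2 × Fin 2) ℤ :=
  Matrix.of fun a j => pauli j a.1 a.2

theorem pauli_transpose_mul_self : ∀ j, (pauli j).transpose * pauli j = (1 : ℤ) • 1 := by decide

theorem pauliSign_transpose_mul_self : pauliSign.transpose * pauliSign = (4 : ℤ) • 1 := by
  decide +kernel

theorem pauliBasis_transpose_mul_self : pauliBasis.transpose * pauliBasis = (2 : ℤ) • 1 := by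
  decide +kernel

/-- The sign turns σⱼᵀσₖ into σₖσⱼᵀ, so the double sum factors. By completeness, ∑ₖ σₖ(a,g)σₖ =
2|a⟩⟨g|; the product of the two sums is 4 times the swap, with the ancilla fixed. -/
theorem sum_pauli : ∀ x y : (Fin 2 × Fin 2) × Fin 2,
    ∑ j, ∑ k, pauliBasis x.1 j * pauliSign j k * pauliBasis y.1 k *
      ((pauli j).transpose * pauli k) x.2 y.2 =
    if x.1.2 = y.1.2 ∧ (x.1.1, x.2) = (y.2, y.1.1) then 4 else 0 := by
  decide +kernel

/-- Lets orthogonality be decided over ℤ, with the normalization applied afterwards. -/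
theorem smul_map_mem_unitaryGroup {n : Type*} [Fintype n] [DecidableEq n] {M : Matrix n n ℤ}
    {c : ℝ} {d : ℤ} (hM : M.transpose * M = d • 1) (hc : c ^ 2 * d = 1) :
    (c : ℂ) • M.map (Int.cast : ℤ → ℂ) ∈ Matrix.unitaryGroup n ℂ := by
  rw [Matrix.mem_unitaryGroup_iff']
  ext x y
  have h := congr_arg (Int.cast : ℤ → ℂ) (congr_fun₂ hM x y)
  simp only [Matrix.mul_apply, Matrix.transpose_apply, Matrix.smul_apply, Matrix.one_apply,
    Int.cast_sum, Int.cast_mul, smul_eq_mul] at h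
  have hc' : (c : ℂ) ^ 2 * d = 1 := by exact_mod_cast hc
  simp only [Matrix.mul_apply, Matrix.star_apply, Matrix.smul_apply, Matrix.map_apply, smul_eq_mul,
    RCLike.star_def, map_mul, Complex.conj_ofReal, map_intCast, Matrix.one_apply]
  calc ∑ j, (c : ℂ) * (M j x : ℂ) * (c * (M j y : ℂ))
      = c ^ 2 * ∑ j, (M j x : ℂ) * (M j y : ℂ) := by
        rw [Finset.mul_sum]; exact Finset.sum_congr rfl fun j _ => by ring
    _ = _ := by rw [h, ← mul_assoc, hc']; simp

theorem depth_tensorQubitA_swapGate_le : depth (tensorQubitA swapGate) ≤ 2 := by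
  set P : Matrix (Fin 2 × Fin 2) (Fin 2 × Fin 2) ℂ :=
    (((√2)⁻¹ : ℝ) : ℂ) • pauliBasis.map (Int.cast : ℤ → ℂ) with hPdef
  set M : Matrix (Fin 2 × Fin 2) (Fin 2 × Fin 2) ℂ :=
    ((2⁻¹ : ℝ) : ℂ) • pauliSign.map (Int.cast : ℤ → ℂ) with hMdef
  set V : Fin 2 × Fin 2 → Matrix (Fin 2) (Fin 2) ℂ :=
    fun j => ((1 : ℝ) : ℂ) • (pauli j).map (Int.cast : ℤ → ℂ) with hVdef
  have hP : P ∈ Matrix.unitaryGroup _ ℂ :=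
    smul_map_mem_unitaryGroup pauliBasis_transpose_mul_self (by norm_num)
  have hM : M ∈ Matrix.unitaryGroup _ ℂ :=
    smul_map_mem_unitaryGroup pauliSign_transpose_mul_self (by norm_num)
  have hV : ∀ j, V j ∈ Matrix.unitaryGroup _ ℂ := fun j =>
    smul_map_mem_unitaryGroup (pauli_transpose_mul_self j) (by norm_num)
  refine Nat.sInf_le ⟨by norm_num,
    [(P ⊗ₖ 1) * (∑ j, Matrix.single j j (1 : ℂ) ⊗ₖ (V j).transpose) * (M ⊗ₖ 1),
      (1 ⊗ₖ 1) * (∑ j, Matrix.single j j (1 : ℂ) ⊗ₖ V j) * (P.transpose ⊗ₖ 1)], rfl, ?_, ?_⟩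
  · simp only [List.mem_cons, List.not_mem_nil, or_false, forall_eq_or_imp, forall_eq]
    exact ⟨Or.inl ⟨P, hP, 1, one_mem _, M, hM, 1, one_mem _, _,
        fun j => transpose_mem_unitaryGroup (hV j), rfl⟩,
      Or.inl ⟨1, one_mem _, 1, one_mem _, _, transpose_mem_unitaryGroup hP, 1, one_mem _, V, hV,
        rfl⟩⟩
  · have hc : ((√2)⁻¹ : ℂ) * ((√2)⁻¹ : ℂ) = 2⁻¹ := by
      rw [← mul_inv]; norm_cast; simp
    rw [List.prod_cons, List.prod_cons, List.prod_nil, mul_one,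
      kronecker_mul_sum_mul_kronecker, kronecker_mul_sum_mul_kronecker, Finset.sum_mul_sum]
    ext x y
    simp only [← Matrix.mul_kronecker_mul, one_mul, mul_one, Matrix.sum_apply,
      Matrix.kroneckerMap_apply]
    have hentry (j k : Fin 2 × Fin 2) :
        (P * Matrix.single j j (1 : ℂ) * M * (Matrix.single k k (1 : ℂ) * P.transpose) :
          Matrix (Fin 2 × Fin 2) (Fin 2 × Fin 2) ℂ) x.1 y.1 =
          P x.1 j * M j k * P y.1 k := by
      rw [← mul_assoc, mul_assoc _ M, mul_assoc P, ← mul_assoc _ M, Matrix.single_mul_mul_single]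
      simp [Matrix.mul_apply, Matrix.single_apply, ite_and]
    -- The factor 1/4 is (1/√2)² from the two copies of `P` times 1/2 from `M`.
    have hterm (j k : Fin 2 × Fin 2) :
        P x.1 j * M j k * P y.1 k * ((V j).transpose * V k) x.2 y.2 =
          4⁻¹ * ((pauliBasis x.1 j * pauliSign j k * pauliBasis y.1 k *
            ((pauli j).transpose * pauli k) x.2 y.2 : ℤ) : ℂ) := by
      simp [hPdef, hMdef, hVdef, Matrix.mul_apply]
      linear_combination 2⁻¹ * (pauliBasis x.1 j * pauliSign j k * pauliBasis y.1 k *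
            (pauli j 0 x.2 * pauli k 0 y.2 + pauli j 1 x.2 * pauli k 1 y.2) : ℂ) * hc
    simp only [hentry, hterm, ← Finset.mul_sum, ← Int.cast_sum, sum_pauli]
    rw [tensorQubitA_apply]
    simp only [swapGate, Matrix.of_apply, Prod.swap, ite_and]
    split_ifs <;> norm_num

end Swap

end BipartiteDepth

theorem proposition6 :
    (∀ (dA dB : ℕ) (U : Matrix (Fin dA × Fin dB) (Fin dA × Fin dB) ℂ),
      U ∈ Matrix.unitaryGroup (Fin dA × Fin dB) ℂ →
        (∃ k, BipartiteDepth.IsProductOfControlled U k) ∧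
        (∃ k, BipartiteDepth.IsProductOfControlled (BipartiteDepth.tensorQubitA U) k) ∧
        BipartiteDepth.depth (BipartiteDepth.tensorQubitA U) ≤ BipartiteDepth.depth U) ∧
    (∃ (dA dB : ℕ) (U : Matrix (Fin dA × Fin dB) (Fin dA × Fin dB) ℂ),
      U ∈ Matrix.unitaryGroup (Fin dA × Fin dB) ℂ ∧
        BipartiteDepth.depth (BipartiteDepth.tensorQubitA U) < BipartiteDepth.depth U) := by
  refine ⟨fun dA dB U hU => ?_, 2, 2, BipartiteDepth.swapGate,
    BipartiteDepth.swapGate_mem_unitaryGroup,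
    BipartiteDepth.depth_tensorQubitA_swapGate_le.trans_lt BipartiteDepth.two_lt_depth_swapGate⟩
  have h := BipartiteDepth.exists_isProductOfControlled hU
  exact ⟨h, h.imp fun k hk => hk.tensorQubitA, BipartiteDepth.depth_tensorQubitA_le h⟩
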